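/- Let $N\ge 2$, $\mathbb{Z}_N=\{0,\dots,N-1\}$, and let $(S_i)_{i\in\mathbb{Z}_N}$ be a representation of the Cuntz algebra $\mathcal{O}_N$ on a complex Hilbert space $\mathcal{H}$, i.e. bounded operators with $S_i^*S_j=\delta_{ij}I$ and $\sum_{i}S_iS_i^*=I$. For a finite word $I=i_1\dots i_n$ put $S_I=S_{i_1}\cdots S_{i_n}$. Let $\mathcal{K}=\mathbb{Z}_N^{\mathbb{N}}$ be the Cantor group (product topology, Borel $\sigma$-algebra $\mathcal{B}(\mathcal{K})$), $\mathcal{C}(I)=\{\omega\in\mathcal{K}:\omega_1=i_1,\dots,\omega_n=i_n\}$, $\sigma(\omega_1\omega_2\dots)=\omega_2\omega_3\dots$ and $\sigma_i(\omega_1\omega_2\dots)=i\omega_1\omega_2\dots$. Let $\widehat{\mathcal{K}}$ be the dual group, i.e. the group of sequences $\xi=(\xi_1\xi_2\dots)$ in $\mathbb{Z}_N$ with finitely many non-zero terms, with duality $\langle\omega,\xi\rangle=\prod_k e^{2\pi i\omega_k\xi_k/N}$, let $\widehat\sigma(\xi_1\xi_2\dots)=(0\xi_1\xi_2\dots)$,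 and for a word $I$ put $\langle I,\xi\rangle=\langle I00\dots,\xi\rangle$. Then the following hold. 1. There is a unique projection-valued measure $P$ on $\mathcal{B}(\mathcal{K})$ with $P(\mathcal{C}(I))=S_IS_I^*$ for every finite word $I$. 2. For $\xi=\xi_1\dots\xi_n00\dots\in\widehat{\mathcal{K}}$ the operator $U(\xi)=\sum_{I\in\mathbb{Z}_N^n}\langle I,\xi\rangle S_IS_I^*$ does not depend on the choice of $n$, and $U$ is a unitary representation of $\widehat{\mathcal{K}}$ on $\mathcal{H}$. 3. $P$ is the spectral decomposition of $U$, i.e. $U(\xi)=\int_{\mathcal{K}}\langle\omega,\xi\rangle\,P(d\omega)$ for all $\xi\in\widehat{\mathcal{K}}$. 4. For all $i\in\mathbb{Z}_N$ and $A\in\mathcal{B}(\mathcal{K})$: $S_iP(A)S_i^*=P(\sigma_i(A))$ and $\sum_{j\in\mathbb{Z}_N}S_jP(\sigma_j^{-1}(A))S_j^*=P(A)$. 5. The map $\alpha(T)=\sum_{i\in\mathbb{Z}_N}S_iTS_i^*$ is a (unital $*$-)endomorphism of $B(\mathcal{H})$, and $\alpha(P(A))=P(\sigma^{-1}(A))$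 for all $A\in\mathcal{B}(\mathcal{K})$. 6. $\alpha\left(\int_{\mathcal{K}}f\,dP\right)=\int_{\mathcal{K}}f\circ\sigma\,dP$ for every bounded measurable $f:\mathcal{K}\to\mathbb{C}$, and $\alpha(U(\xi))=U(\widehat\sigma(\xi))$ for all $\xi\in\widehat{\mathcal{K}}$. -/

import Mathlib

open MeasureTheory

noncomputable section

/-! ### Projection-valued measures -/

/-- A projection-valued measure on the measurable space `X`, acting on the Hilbert space `H`:
a map `P` from measurable sets to orthogonal projections with `P X = 1`,
`P (A ∩ B) = P A * P B`, countably additive in the strong operator topology.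
The value on non-measurable sets is set to `0`, so that `P` is determined by its values on
measurable sets. -/
structure ProjectionValuedMeasure (X : Type*) [MeasurableSpace X] (H : Type*)
    [NormedAddCommGroup H] [InnerProductSpace ℂ H] [CompleteSpace H] where
  /-- The underlying set function. -/
  toFun : Set X → H →L[ℂ] H
  isStarProjection' : ∀ A, MeasurableSet A → IsStarProjection (toFun A)
  univ' : toFun Set.univ = 1
  inter' : ∀ A B, MeasurableSet A → MeasurableSet B → toFun (A ∩ B) = toFun A * toFun B
  hasSum' : ∀ A : ℕ → Set X, (∀ n, MeasurableSet (A n)) → Pairwise (Function.onFun Disjoint A) →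
    ∀ ψ : H, HasSum (fun n => toFun (A n) ψ) (toFun (⋃ n, A n) ψ)
  not_measurable' : ∀ A, ¬ MeasurableSet A → toFun A = 0

namespace ProjectionValuedMeasure

variable {X : Type*} [MeasurableSpace X] {H : Type*}
  [NormedAddCommGroup H] [InnerProductSpace ℂ H] [CompleteSpace H]

instance : CoeFun (ProjectionValuedMeasure X H) (fun _ => Set X → H →L[ℂ] H) := ⟨toFun⟩

theorem inner_self (P : ProjectionValuedMeasure X H) {A : Set X} (hA : MeasurableSet A) (ψ : H) :
    inner ℂ ψ (P A ψ) = ((‖P A ψ‖ ^ 2 : ℝ) : ℂ) := by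
  have h := P.isStarProjection' A hA
  have h1 : P A (P A ψ) = P A ψ := DFunLike.congr_fun h.isIdempotentElem.eq ψ
  have h2 : ContinuousLinearMap.adjoint (P A) = P A := h.isSelfAdjoint.star_eq
  have h3 : inner ℂ (P A ψ) (P A ψ) = inner ℂ ψ (P A ψ) := by
    rw [← ContinuousLinearMap.adjoint_inner_right, h2, h1]
  rw [← h3, inner_self_eq_norm_sq_to_K]
  push_cast
  rfl

theorem empty (P : ProjectionValuedMeasure X H) : P ∅ = 0 := by
  ext ψ
  have h := P.hasSum' (fun _ => ∅) (fun _ => MeasurableSet.empty)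
    (fun _ _ _ => by simp [Function.onFun]) ψ
  have := h.summable.tendsto_atTop_zero
  simpa using tendsto_nhds_unique tendsto_const_nhds this

/-- The scalar measure `μ_ψ(A) = ‖P(A)ψ‖² = ⟪ψ, P(A)ψ⟫`. -/
def scalarMeasure (P : ProjectionValuedMeasure X H) (ψ : H) : Measure X :=
  Measure.ofMeasurable (fun A _ => ENNReal.ofReal (‖P A ψ‖ ^ 2))
    (by simp [P.empty])
    (by
      intro A hA hd
      have h := (P.hasSum' A hA hd ψ).mapL (innerSL ℂ ψ)
      simp only [innerSL_apply_apply, P.inner_self (hA _), P.inner_self (MeasurableSet.iUnion hA)]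
        at h
      have h' : HasSum (fun n => ‖P (A n) ψ‖ ^ 2) (‖P (⋃ n, A n) ψ‖ ^ 2) :=
        Complex.hasSum_ofReal.mp h
      rw [← h'.tsum_eq, ENNReal.ofReal_tsum_of_nonneg (fun _ => by positivity) h'.summable])

theorem scalarMeasure_apply (P : ProjectionValuedMeasure X H) (ψ : H) {A : Set X}
    (hA : MeasurableSet A) : P.scalarMeasure ψ A = ENNReal.ofReal (‖P A ψ‖ ^ 2) :=
  Measure.ofMeasurable_apply A hA

instance (P : ProjectionValuedMeasure X H) (ψ : H) : IsFiniteMeasure (P.scalarMeasure ψ) :=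
  ⟨by rw [P.scalarMeasure_apply ψ MeasurableSet.univ]; exact ENNReal.ofReal_lt_top⟩

theorem scalarMeasure_real_univ (P : ProjectionValuedMeasure X H) (ψ : H) :
    (P.scalarMeasure ψ).real Set.univ = ‖ψ‖ ^ 2 := by
  rw [Measure.real, P.scalarMeasure_apply ψ MeasurableSet.univ, P.univ',
    ENNReal.toReal_ofReal (by positivity)]
  simp

/-- `T` is the integral of `f` against `P`: `⟪ψ, T ψ⟫ = ∫ f dμ_ψ` for all `ψ`. By polarization
at most one bounded operator `T` has this property. -/
def HasIntegral (P : ProjectionValuedMeasure X H) (f : X → ℂ) (T : H →L[ℂ] H) : Prop :=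
  ∀ ψ : H, inner ℂ ψ (T ψ) = ∫ x, f x ∂(P.scalarMeasure ψ)

theorem HasIntegral.unique {P : ProjectionValuedMeasure X H} {f : X → ℂ} {T T' : H →L[ℂ] H}
    (h : P.HasIntegral f T) (h' : P.HasIntegral f T') : T = T' := by
  have : (T : H →ₗ[ℂ] H) = T' := by
    rw [← ext_inner_map]
    intro ψ
    have := (h ψ).trans (h' ψ).symm
    simpa using congrArg (starRingEnd ℂ) this
  exact ContinuousLinearMap.coe_injective this

/-- Bounded measurable complex functions. -/
def IsBoundedMeasurable (f : X → ℂ) : Prop :=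
  Measurable f ∧ ∃ C : ℝ, ∀ x, ‖f x‖ ≤ C

theorem IsBoundedMeasurable.integrable {f : X → ℂ} (hf : IsBoundedMeasurable f)
    (μ : Measure X) [IsFiniteMeasure μ] : Integrable f μ := by
  obtain ⟨hm, C, hC⟩ := hf
  exact Integrable.of_bound hm.aestronglyMeasurable C (Filter.Eventually.of_forall hC)

theorem isBoundedMeasurable_simpleFunc (s : SimpleFunc X ℂ) : IsBoundedMeasurable s :=
  ⟨s.measurable, s.exists_forall_norm_le⟩

theorem hasIntegral_simpleFunc (P : ProjectionValuedMeasure X H) (s : SimpleFunc X ℂ) :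
    ∃ T, P.HasIntegral s T := by
  induction s using SimpleFunc.induction with
  | const c hs =>
    rename_i A
    refine ⟨c • P A, fun ψ => ?_⟩
    have h1 : (fun x => (SimpleFunc.piecewise A hs (SimpleFunc.const X c)
        (SimpleFunc.const X 0)) x) = A.indicator (fun _ => c) := by
      ext x
      simp [SimpleFunc.coe_piecewise, Set.piecewise, Set.indicator]
    rw [h1, integral_indicator_const _ hs, Measure.real, P.scalarMeasure_apply ψ hs,
      ENNReal.toReal_ofReal (by positivity), _root_.smul_apply, inner_smul_right,
      P.inner_self hs, Complex.real_smul, mul_comm]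
  | add hd h1 h2 =>
    rename_i f g
    obtain ⟨T, hT⟩ := h1
    obtain ⟨T', hT'⟩ := h2
    refine ⟨T + T', fun ψ => ?_⟩
    have := integral_add ((isBoundedMeasurable_simpleFunc f).integrable (P.scalarMeasure ψ))
      ((isBoundedMeasurable_simpleFunc g).integrable (P.scalarMeasure ψ))
    simp only [SimpleFunc.coe_add, Pi.add_apply, _root_.add_apply, inner_add_right,
      hT ψ, hT' ψ, this]

theorem HasIntegral.opNorm_sub_le {P : ProjectionValuedMeasure X H} {f g : X → ℂ}
    {T T' : H →L[ℂ] H} (hT : P.HasIntegral f T) (hT' : P.HasIntegral g T')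
    (hf : IsBoundedMeasurable f) (hg : IsBoundedMeasurable g) {C : ℝ} (hC0 : 0 ≤ C)
    (hC : ∀ x, ‖f x - g x‖ ≤ C) : ‖T - T'‖ ≤ 4 * C := by
  have hq : ∀ ψ, ‖inner ℂ ((T - T') ψ) ψ‖ ≤ C * ‖ψ‖ ^ 2 := by
    intro ψ
    rw [norm_inner_symm, _root_.sub_apply, inner_sub_right, hT ψ, hT' ψ,
      ← integral_sub (hf.integrable _) (hg.integrable _), ← P.scalarMeasure_real_univ ψ]
    exact norm_integral_le_of_norm_le_const (Filter.Eventually.of_forall hC)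
  have hb : ∀ x y : H, ‖x‖ = 1 → ‖y‖ = 1 → ‖inner ℂ ((T - T') y) x‖ ≤ 4 * C := by
    intro x y hx hy
    have key : ∀ u : H, ‖u‖ ≤ 2 → ‖inner ℂ ((T - T') u) u‖ ≤ 4 * C := by
      intro u hu
      refine (hq u).trans ?_
      nlinarith [norm_nonneg u, mul_le_mul hu hu (norm_nonneg u) (by norm_num)]
    have hp := inner_map_polarization ((T - T' : H →L[ℂ] H) : H →ₗ[ℂ] H) x y
    simp only [ContinuousLinearMap.coe_coe] at hp
    have hI : ‖Complex.I • y‖ = 1 := by rw [norm_smul, Complex.norm_I, hy, one_mul]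
    have a1 := key (x + y) (by linarith [norm_add_le x y])
    have a2 := key (x - y) (by linarith [norm_sub_le x y])
    have a3 := key (x + Complex.I • y) (by linarith [norm_add_le x (Complex.I • y)])
    have a4 := key (x - Complex.I • y) (by linarith [norm_sub_le x (Complex.I • y)])
    rw [hp, norm_div]
    have h4 : ‖(4 : ℂ)‖ = 4 := by norm_num
    rw [h4, div_le_iff₀ (by norm_num)]
    refine (norm_sub_le _ _).trans ?_
    refine (add_le_add_left (norm_add_le _ _) _).trans ?_
    refine (add_le_add_left (add_le_add_left (norm_sub_le _ _) _) _).trans ?_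
    simp only [norm_mul, Complex.norm_I, one_mul]
    linarith
  refine ContinuousLinearMap.opNorm_le_bound _ (by linarith) fun y => ?_
  by_cases hy : y = 0
  · simp [hy]
  by_cases hz : (T - T') y = 0
  · rw [hz, norm_zero]; positivity
  have hy' : (‖y‖ : ℂ) ≠ 0 := by simpa using hy
  have hz' : (‖(T - T') y‖ : ℂ) ≠ 0 := by
    rw [Complex.ofReal_ne_zero]; exact norm_ne_zero_iff.mpr hz
  have hyr : 0 < ‖y‖ := norm_pos_iff.mpr hy
  have hzr : 0 < ‖(T - T') y‖ := norm_pos_iff.mpr hz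
  have h := hb ((‖(T - T') y‖ : ℂ)⁻¹ • (T - T') y) ((‖y‖ : ℂ)⁻¹ • y)
    (by rw [norm_smul, norm_inv, Complex.norm_real, norm_norm, inv_mul_cancel₀ hzr.ne'])
    (by rw [norm_smul, norm_inv, Complex.norm_real, norm_norm, inv_mul_cancel₀ hyr.ne'])
  rw [map_smul, inner_smul_left, inner_smul_right, inner_self_eq_norm_sq_to_K, norm_mul, norm_mul,
    RCLike.norm_conj, norm_inv, norm_inv, Complex.norm_real, Complex.norm_real, norm_norm,
    norm_norm, norm_pow] at h
  have h5 : ‖((‖(T - T') y‖ : ℝ) : ℂ)‖ = ‖(T - T') y‖ := by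
    rw [Complex.norm_real, norm_norm]
  change ‖y‖⁻¹ * (‖(T - T') y‖⁻¹ * ‖((‖(T - T') y‖ : ℝ) : ℂ)‖ ^ 2) ≤ 4 * C at h
  rw [h5, pow_two, inv_mul_cancel_left₀ hzr.ne', inv_mul_le_iff₀ hyr] at h
  linarith

theorem exists_simpleFunc_near {f : X → ℂ} (hf : IsBoundedMeasurable f) {ε : ℝ} (hε : 0 < ε) :
    ∃ s : SimpleFunc X ℂ, ∀ x, ‖f x - s x‖ ≤ ε := by
  obtain ⟨hm, C, hC⟩ := hf
  have hδ : 0 < ε / 2 := by positivity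
  set δ := ε / 2 with hδdef
  let q : ℝ → ℤ := fun r => ⌊r / δ⌋
  let e : ℤ × ℤ → ℂ := fun p => ⟨p.1 * δ, p.2 * δ⟩
  let g : X → ℤ × ℤ := fun x => (q (f x).re, q (f x).im)
  have hqm : Measurable q := Int.measurable_floor.comp (measurable_id.div_const δ)
  have hg : Measurable g :=
    (hqm.comp (Complex.measurable_re.comp hm)).prodMk (hqm.comp (Complex.measurable_im.comp hm))
  have he : Measurable e := measurable_of_countable e
  have hqr : ∀ r, |r| ≤ C → q r ∈ Set.Icc (q (-C)) (q C) := by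
    intro r hr
    have := abs_le.mp hr
    constructor
    · exact Int.floor_le_floor (by gcongr; exact this.1)
    · exact Int.floor_le_floor (by gcongr; exact this.2)
  have hfin : (Set.range (e ∘ g)).Finite := by
    rw [Set.range_comp]
    refine Set.Finite.image _ (((Set.finite_Icc (q (-C)) (q C)).prod
      (Set.finite_Icc (q (-C)) (q C))).subset ?_)
    rintro _ ⟨x, rfl⟩
    exact ⟨hqr _ ((Complex.abs_re_le_norm _).trans (hC x)),
      hqr _ ((Complex.abs_im_le_norm _).trans (hC x))⟩
  have hnear : ∀ r : ℝ, |r - q r * δ| ≤ δ := by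
    intro r
    have h1 : (q r : ℝ) * δ ≤ r := (le_div_iff₀ hδ).mp (Int.floor_le _)
    have h2 : r < (q r + 1 : ℝ) * δ := (div_lt_iff₀ hδ).mp (Int.lt_floor_add_one _)
    rw [abs_le]
    constructor <;> nlinarith
  refine ⟨⟨e ∘ g, fun y => (he.comp hg) (measurableSet_singleton y), hfin⟩, fun x => ?_⟩
  refine (Complex.norm_le_abs_re_add_abs_im _).trans ?_
  have h1 := hnear (f x).re
  have h2 := hnear (f x).im
  change |(f x).re - q (f x).re * δ| + |(f x).im - q (f x).im * δ| ≤ ε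
  linarith

theorem exists_hasIntegral (P : ProjectionValuedMeasure X H) {f : X → ℂ}
    (hf : IsBoundedMeasurable f) : ∃ T, P.HasIntegral f T := by
  have hpos : ∀ n : ℕ, (0 : ℝ) < 1 / ((n : ℝ) + 1) := fun n => by positivity
  choose s hs using fun n : ℕ => exists_simpleFunc_near hf (hpos n)
  choose T hT using fun n => P.hasIntegral_simpleFunc (s n)
  have hlim : Filter.Tendsto (fun n : ℕ => 1 / ((n : ℝ) + 1)) Filter.atTop (nhds 0) :=
    tendsto_one_div_add_atTop_nhds_zero_nat
  have hc : CauchySeq T := by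
    refine cauchySeq_of_le_tendsto_0 (fun n : ℕ => 8 * (1 / ((n : ℝ) + 1))) ?_
      (by simpa using hlim.const_mul 8)
    intro n m k hn hm
    rw [dist_eq_norm]
    have hmono : ∀ j, k ≤ j → 1 / ((j : ℝ) + 1) ≤ 1 / ((k : ℝ) + 1) := by
      intro j hj
      gcongr
    refine ((hT n).opNorm_sub_le (hT m) (isBoundedMeasurable_simpleFunc _)
      (isBoundedMeasurable_simpleFunc _) (C := 2 * (1 / ((k : ℝ) + 1))) (by positivity) ?_).trans
      (by linarith)
    intro x
    have h1 := (hs n x).trans (hmono n hn)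
    have h2 := (hs m x).trans (hmono m hm)
    have h3 : s n x - s m x = (f x - s m x) - (f x - s n x) := by ring
    rw [h3]
    exact (norm_sub_le _ _).trans (by linarith)
  obtain ⟨T₀, hT₀⟩ := cauchySeq_tendsto_of_complete hc
  refine ⟨T₀, fun ψ => ?_⟩
  have l1 : Filter.Tendsto (fun n => inner ℂ ψ (T n ψ)) Filter.atTop
      (nhds (inner ℂ ψ (T₀ ψ))) :=
    tendsto_const_nhds.inner (((ContinuousLinearMap.apply ℂ H ψ).continuous.tendsto T₀).comp hT₀)
  have l2 : Filter.Tendsto (fun n => ∫ x, s n x ∂(P.scalarMeasure ψ)) Filter.atTop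
      (nhds (∫ x, f x ∂(P.scalarMeasure ψ))) := by
    rw [tendsto_iff_norm_sub_tendsto_zero]
    refine squeeze_zero (fun _ => norm_nonneg _) (fun n => ?_)
      (by simpa using hlim.mul_const (‖ψ‖ ^ 2))
    rw [← integral_sub ((isBoundedMeasurable_simpleFunc _).integrable _) (hf.integrable _),
      ← P.scalarMeasure_real_univ ψ]
    refine norm_integral_le_of_norm_le_const (Filter.Eventually.of_forall fun x => ?_)
    rw [norm_sub_rev]
    simpa using hs n x
  have l3 : (fun n => inner ℂ ψ (T n ψ)) = fun n => ∫ x, s n x ∂(P.scalarMeasure ψ) :=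
    funext fun n => hT n ψ
  rw [l3] at l1
  exact tendsto_nhds_unique l1 l2

open Classical in
/-- The integral `∫ f dP` of a bounded measurable function: the unique bounded operator `T` with
`⟪ψ, T ψ⟫ = ∫ f dμ_ψ` for all `ψ` (and `0` for any other function). -/
def integral (P : ProjectionValuedMeasure X H) (f : X → ℂ) : H →L[ℂ] H :=
  if h : IsBoundedMeasurable f then (P.exists_hasIntegral h).choose else 0

theorem hasIntegral_integral (P : ProjectionValuedMeasure X H) {f : X → ℂ}
    (hf : IsBoundedMeasurable f) : P.HasIntegral f (P.integral f) := by
  rw [integral, dif_pos hf]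
  exact (P.exists_hasIntegral hf).choose_spec

end ProjectionValuedMeasure

/-! ### Cuntz relations, words and the Cantor group -/

namespace Cuntz

/-- A representation of the Cuntz algebra `𝒪_N` on `H`, given by the images `S i` of the
generators: bounded operators satisfying the Cuntz relations. -/
structure IsRepresentation {N : ℕ} [NeZero N] {H : Type*} [NormedAddCommGroup H]
    [InnerProductSpace ℂ H] [CompleteSpace H] (S : ZMod N → H →L[ℂ] H) : Prop where
  star_mul : ∀ i j, star (S i) * S j = if i = j then 1 else 0
  sum_mul_star : ∑ i, S i * star (S i) = 1

/-- The operator `S_I = S_{i_1} ⋯ S_{i_n}` for a word `I = i_1 … i_n` of length `n`. -/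
def wordOp {N : ℕ} {H : Type*} [NormedAddCommGroup H] [InnerProductSpace ℂ H]
    (S : ZMod N → H →L[ℂ] H) {n : ℕ} (I : Fin n → ZMod N) : H →L[ℂ] H :=
  (List.ofFn fun k => S (I k)).prod

/-- The Cantor group on `N` letters, with the product topology, the Borel σ-algebra
(which is the product σ-algebra) and coordinatewise addition. Letters are indexed from `0`. -/
abbrev CantorGroup (N : ℕ) : Type := ℕ → ZMod N

theorem borelSpace_cantorGroup (N : ℕ) [NeZero N] : BorelSpace (CantorGroup N) := inferInstance

/-- The dual group of the Cantor group: sequences with finitely many non-zero terms. -/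
abbrev DualGroup (N : ℕ) : Type := ℕ →₀ ZMod N

/-- The cylinder set of a finite word. -/
def cylinder {N n : ℕ} (I : Fin n → ZMod N) : Set (CantorGroup N) :=
  {ω | ∀ k : Fin n, ω k = I k}

/-- The shift `σ(ω₁ω₂…) = ω₂ω₃…`. -/
def shift {N : ℕ} (ω : CantorGroup N) : CantorGroup N := fun k => ω (k + 1)

/-- The inverse branches `σ_i(ω₁ω₂…) = iω₁ω₂…` of the shift. -/
def prepend {N : ℕ} (i : ZMod N) (ω : CantorGroup N) : CantorGroup N
  | 0 => i
  | k + 1 => ω k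

/-- The Fourier duality `⟨ω, ξ⟩ = ∏ₖ exp (2πi ωₖ ξₖ / N)`; the factors with `ξₖ = 0` are `1`. -/
def pairing {N : ℕ} (ω : CantorGroup N) (ξ : DualGroup N) : ℂ :=
  ∏ k ∈ ξ.support,
    Complex.exp (2 * Real.pi * Complex.I * (((ω k).val : ℂ) * ((ξ k).val : ℂ)) / (N : ℂ))

/-- The infinite word `I00…`. -/
def extendZero {N n : ℕ} (I : Fin n → ZMod N) : CantorGroup N :=
  fun k => if h : k < n then I ⟨k, h⟩ else 0

/-- The dual of the shift, `σ̂(ξ₁ξ₂…) = 0ξ₁ξ₂…`. -/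
def dualShift {N : ℕ} (ξ : DualGroup N) : DualGroup N :=
  Finsupp.embDomain ⟨Nat.succ, Nat.succ_injective⟩ ξ

/-- The defining property of the dual of the shift. -/
theorem pairing_dualShift {N : ℕ} (ω : CantorGroup N) (ξ : DualGroup N) :
    pairing ω (dualShift ξ) = pairing (shift ω) ξ := by
  unfold pairing dualShift
  rw [Finsupp.support_embDomain, Finset.prod_map]
  refine Finset.prod_congr rfl fun k _ => ?_
  rw [Finsupp.embDomain_apply_self]
  rfl

end Cuntz

end

/-! An orthogonal projection `T` is determined by its quadratic form `⟪ψ, T ψ⟫ = ‖T ψ‖²`, so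
statements about `P` become statements about the finite measures `μ_ψ(A) = ‖P(A)ψ‖²`. Cylinders form
a generating π-system, and finite measures that agree there are equal; this gives uniqueness.

For existence, `μ_ψ` must give mass `‖S_I* ψ‖²` to the cylinder of `I`. Atomic measures do so for
all words of length at most `n`. The Cantor group is compact, so they have a weak cluster point, and
cylinders are clopen, so the masses survive (`exists_measure_cylinder`). The sets whose `μ_ψ`-mass
is `‖T ψ‖²` for a projection `T` then grow from cylinders to all Borel sets
(`exists_isStarProjection_of_generateFrom`): disjoint sets have total mass at most `‖ψ‖²`, which
forces their projections to be orthogonal, and increasing projections converge strongly.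

A character depends on finitely many letters, so its integral is a finite sum over cylinders; this
is `U`. The covariance relations all follow from the self-similarity `μ_ψ = ∑ᵢ (σᵢ)_* μ_{Sᵢ*ψ}`
(`scalarMeasure_eq_sum_map_prepend`) together with `σ ∘ σᵢ = id`. -/

noncomputable section

/-! ### Orthogonal projections and their quadratic forms -/

section StarProjection

theorem ContinuousLinearMap.ext_inner_apply_self {H : Type*} [NormedAddCommGroup H]
    [InnerProductSpace ℂ H] {T T' : H →L[ℂ] H}
    (h : ∀ ψ, inner ℂ ψ (T ψ) = inner ℂ ψ (T' ψ)) : T = T' := by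
  have : (T : H →ₗ[ℂ] H) = T' := by
    rw [← ext_inner_map]
    intro ψ
    -- `ext_inner_map` has the operator in the first slot, hence the conjugation.
    simpa using congrArg (starRingEnd ℂ) (h ψ)
  exact ContinuousLinearMap.coe_injective this

variable {H : Type*} [NormedAddCommGroup H] [InnerProductSpace ℂ H] [CompleteSpace H]

theorem IsStarProjection.inner_apply_self {T : H →L[ℂ] H} (hT : IsStarProjection T) (ψ : H) :
    inner ℂ ψ (T ψ) = ((‖T ψ‖ ^ 2 : ℝ) : ℂ) := by
  have h1 : T (T ψ) = T ψ := DFunLike.congr_fun hT.isIdempotentElem.eq ψ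
  have h2 : ContinuousLinearMap.adjoint T = T := hT.isSelfAdjoint.star_eq
  have h3 : inner ℂ (T ψ) (T ψ) = inner ℂ ψ (T ψ) := by
    rw [← ContinuousLinearMap.adjoint_inner_right, h2, h1]
  rw [← h3, inner_self_eq_norm_sq_to_K]
  push_cast
  rfl

theorem IsStarProjection.ext_norm_apply {T T' : H →L[ℂ] H} (hT : IsStarProjection T)
    (hT' : IsStarProjection T') (h : ∀ ψ, ‖T ψ‖ ^ 2 = ‖T' ψ‖ ^ 2) : T = T' :=
  ContinuousLinearMap.ext_inner_apply_self fun ψ => by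
    rw [hT.inner_apply_self, hT'.inner_apply_self, h]

theorem IsStarProjection.norm_sq_one_sub_apply {T : H →L[ℂ] H} (hT : IsStarProjection T) (ψ : H) :
    ‖(1 - T) ψ‖ ^ 2 = ‖ψ‖ ^ 2 - ‖T ψ‖ ^ 2 := by
  have h1 := hT.one_sub.inner_apply_self ψ
  have h2 : inner ℂ ψ ψ = ((‖ψ‖ ^ 2 : ℝ) : ℂ) :=
    (IsStarProjection.one (R := H →L[ℂ] H)).inner_apply_self ψ
  have h3 : inner ℂ ψ ((1 - T) ψ) = inner ℂ ψ ψ - inner ℂ ψ (T ψ) := inner_sub_right ψ ψ (T ψ)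
  rw [h3, hT.inner_apply_self, h2] at h1
  exact_mod_cast h1.symm

/-- Evaluate the inequality at `T ψ`, which `T` fixes: no room is left for `T' (T ψ)`. This turns
additivity of masses into orthogonality of projections. -/
theorem IsStarProjection.mul_eq_zero_of_norm_sq_add_le {T T' : H →L[ℂ] H}
    (hT : IsStarProjection T) (h : ∀ ψ, ‖T ψ‖ ^ 2 + ‖T' ψ‖ ^ 2 ≤ ‖ψ‖ ^ 2) : T' * T = 0 := by
  ext ψ
  have h1 : T (T ψ) = T ψ := DFunLike.congr_fun hT.isIdempotentElem.eq ψ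
  have h2 := h (T ψ)
  rw [h1] at h2
  have h3 : ‖T' (T ψ)‖ ^ 2 = 0 := le_antisymm (by linarith) (by positivity)
  simpa using h3

theorem IsStarProjection.add_of_norm_sq_add_le {T T' : H →L[ℂ] H}
    (hT : IsStarProjection T) (hT' : IsStarProjection T')
    (h : ∀ ψ, ‖T ψ‖ ^ 2 + ‖T' ψ‖ ^ 2 ≤ ‖ψ‖ ^ 2) : IsStarProjection (T + T') := by
  have h1 := hT.mul_eq_zero_of_norm_sq_add_le h
  have h2 := hT'.mul_eq_zero_of_norm_sq_add_le fun ψ => (add_comm _ _).trans_le (h ψ)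
  refine ⟨?_, hT.isSelfAdjoint.add hT'.isSelfAdjoint⟩
  rw [IsIdempotentElem, add_mul, mul_add, mul_add, h1, h2, hT.isIdempotentElem.eq,
    hT'.isIdempotentElem.eq, add_zero, zero_add]

theorem IsStarProjection.norm_sq_add_apply {T T' : H →L[ℂ] H}
    (hT : IsStarProjection T) (hT' : IsStarProjection T') (hTT' : IsStarProjection (T + T'))
    (ψ : H) : ‖(T + T') ψ‖ ^ 2 = ‖T ψ‖ ^ 2 + ‖T' ψ‖ ^ 2 := by
  have h := hTT'.inner_apply_self ψ
  rw [_root_.add_apply, inner_add_right, hT.inner_apply_self, hT'.inner_apply_self] at h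
  exact_mod_cast h.symm

/-- An increasing sequence of orthogonal projections converges strongly to an orthogonal
projection. -/
theorem exists_isStarProjection_tendsto {T : ℕ → H →L[ℂ] H} (hT : ∀ n, IsStarProjection (T n))
    (hmono : ∀ m n, m ≤ n → T n * T m = T m) :
    ∃ T₀ : H →L[ℂ] H, IsStarProjection T₀ ∧
      ∀ ψ, Filter.Tendsto (fun n => T n ψ) Filter.atTop (nhds (T₀ ψ)) := by
  choose hK hTK using fun n => isStarProjection_iff_eq_starProjection_range.mp (hT n)
  -- The ranges increase, so the strong limit is the projection onto the closure of their union.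
  have hU : Monotone fun n => (T n).range := by
    rintro m n hmn _ ⟨ψ, rfl⟩
    exact ⟨T m ψ, DFunLike.congr_fun (hmono m n hmn) ψ⟩
  refine ⟨(⨆ n, (T n).range).topologicalClosure.starProjection,
    isStarProjection_starProjection, fun ψ => ?_⟩
  have := Submodule.starProjection_tendsto_closure_iSup (fun n => (T n).range) hU ψ
  refine this.congr fun n => ?_
  conv_rhs => rw [hTK n]

end StarProjection

/-! ### Projection-valued measures and their scalar measures -/

namespace ProjectionValuedMeasure

variable {X : Type*} [mX : MeasurableSpace X] {H : Type*}
  [NormedAddCommGroup H] [InnerProductSpace ℂ H] [CompleteSpace H]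

theorem scalarMeasure_real_apply (P : ProjectionValuedMeasure X H) (ψ : H) {A : Set X}
    (hA : MeasurableSet A) : (P.scalarMeasure ψ).real A = ‖P A ψ‖ ^ 2 := by
  rw [Measure.real, P.scalarMeasure_apply ψ hA, ENNReal.toReal_ofReal (by positivity)]

theorem ext_of_measurableSet {P Q : ProjectionValuedMeasure X H}
    (h : ∀ A, MeasurableSet A → P A = Q A) : P = Q := by
  have h' : P.toFun = Q.toFun := by
    funext A
    by_cases hA : MeasurableSet A
    · exact h A hA
    · rw [P.not_measurable' A hA, Q.not_measurable' A hA]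
  cases P
  cases Q
  simpa using h'

theorem ext_of_generateFrom {P Q : ProjectionValuedMeasure X H} {C : Set (Set X)}
    (hgen : mX = MeasurableSpace.generateFrom C) (hpi : IsPiSystem C)
    (h : ∀ A ∈ C, P A = Q A) : P = Q := by
  refine ext_of_measurableSet fun A hA => ?_
  refine (P.isStarProjection' A hA).ext_norm_apply (Q.isStarProjection' A hA) fun ψ => ?_
  have hmeas : P.scalarMeasure ψ = Q.scalarMeasure ψ := by
    refine ext_of_generate_finite C hgen hpi (fun B hB => ?_) ?_
    · have hBm : MeasurableSet B := hgen ▸ MeasurableSpace.measurableSet_generateFrom hB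
      rw [P.scalarMeasure_apply ψ hBm, Q.scalarMeasure_apply ψ hBm, h B hB]
    · rw [P.scalarMeasure_apply ψ .univ, Q.scalarMeasure_apply ψ .univ, P.univ', Q.univ']
  rw [← P.scalarMeasure_real_apply ψ hA, hmeas, Q.scalarMeasure_real_apply ψ hA]

section Construction

variable {μ : H → Measure X} [∀ ψ, IsFiniteMeasure (μ ψ)]

/-- Induction from the π-system: complements correspond to `1 - T`, and disjoint countable unions to
strong limits of sums of mutually orthogonal projections. -/
theorem exists_isStarProjection_of_generateFrom {C : Set (Set X)}
    (hgen : mX = MeasurableSpace.generateFrom C) (hpi : IsPiSystem C)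
    (huniv : ∀ ψ, (μ ψ).real Set.univ = ‖ψ‖ ^ 2)
    (hC : ∀ A ∈ C, ∃ T : H →L[ℂ] H, IsStarProjection T ∧ ∀ ψ, (μ ψ).real A = ‖T ψ‖ ^ 2)
    (A : Set X) (hA : MeasurableSet A) :
    ∃ T : H →L[ℂ] H, IsStarProjection T ∧ ∀ ψ, (μ ψ).real A = ‖T ψ‖ ^ 2 := by
  induction A, hA using MeasurableSpace.induction_on_inter hgen hpi with
  | empty => exact ⟨0, .zero _, by simp⟩
  | basic A hA => exact hC A hA
  | compl A hA ih =>
    obtain ⟨T, hT, h⟩ := ih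
    refine ⟨1 - T, hT.one_sub, fun ψ => ?_⟩
    rw [hT.norm_sq_one_sub_apply, ← h, ← huniv, measureReal_compl hA]
  | iUnion A hd hA ih =>
    choose T hT h using ih
    let B : ℕ → Set X := fun n => ⋃ i ∈ Finset.range n, A i
    have hB : ∀ n, MeasurableSet (B n) := fun n => Finset.measurableSet_biUnion _ fun i _ => hA i
    have hBsucc : ∀ n, B (n + 1) = B n ∪ A n := fun n => by
      simp only [B, Finset.range_add_one, Finset.set_biUnion_insert, Set.union_comm]
    have hBd : ∀ n, Disjoint (B n) (A n) := fun n => by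
      simp only [B, Set.disjoint_iUnion_left]
      exact fun i hi => hd (Finset.mem_range.mp hi).ne
    -- Two disjoint sets weigh at most the whole space, whose mass is `‖ψ‖²`; this is the hypothesis
    -- that yields orthogonality.
    have hle : ∀ {D D' : Set X} {R R' : H →L[ℂ] H}, MeasurableSet D' → Disjoint D D' →
        (∀ ψ, (μ ψ).real D = ‖R ψ‖ ^ 2) → (∀ ψ, (μ ψ).real D' = ‖R' ψ‖ ^ 2) →
        ∀ ψ, ‖R ψ‖ ^ 2 + ‖R' ψ‖ ^ 2 ≤ ‖ψ‖ ^ 2 := by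
      intro D D' R R' hD' hDD' hR hR' ψ
      rw [← hR, ← hR', ← huniv, ← measureReal_union hDD' hD']
      exact measureReal_mono (Set.subset_univ _)
    let V : ℕ → H →L[ℂ] H := fun n => ∑ i ∈ Finset.range n, T i
    have hVsucc : ∀ n, V (n + 1) = V n + T n := fun n => Finset.sum_range_succ _ _
    have hV : ∀ n, IsStarProjection (V n) ∧ ∀ ψ, (μ ψ).real (B n) = ‖V n ψ‖ ^ 2 := by
      intro n
      induction n with
      | zero => exact ⟨by simp [V], by simp [V, B]⟩
      | succ n ih =>
        have h1 := ih.1.add_of_norm_sq_add_le (hT n) (hle (hA n) (hBd n) ih.2 (h n))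
        rw [hVsucc, hBsucc]
        refine ⟨h1, fun ψ => ?_⟩
        rw [ih.1.norm_sq_add_apply (hT n) h1, measureReal_union (hBd n) (hA n)
          (measure_ne_top _ _) (measure_ne_top _ _), ih.2, h]
    have hTT : ∀ i j, i ≠ j → T i * T j = 0 := fun i j hij =>
      (hT j).mul_eq_zero_of_norm_sq_add_le (hle (hA i) (hd hij.symm) (h j) (h i))
    have hmono : ∀ m n, m ≤ n → V n * V m = V m := by
      intro m n hmn
      induction n, hmn using Nat.le_induction with
      | base => exact (hV m).1.isIdempotentElem.eq
      | succ n hmn ih =>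
        rw [hVsucc, add_mul, ih, Finset.mul_sum, Finset.sum_eq_zero, add_zero]
        intro i hi
        exact hTT n i ((Finset.mem_range.mp hi).trans_le hmn).ne'
    obtain ⟨T₀, hT₀, hlim⟩ := exists_isStarProjection_tendsto (fun n => (hV n).1) hmono
    refine ⟨T₀, hT₀, fun ψ => ?_⟩
    have hBU : ⋃ n, B n = ⋃ n, A n := by
      refine Set.Subset.antisymm (Set.iUnion_subset fun n => Set.iUnion₂_subset fun i _ =>
        Set.subset_iUnion A i) (Set.iUnion_subset fun n => ?_)
      exact Set.subset_iUnion_of_subset (n + 1) (by rw [hBsucc]; exact Set.subset_union_right)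
    have hBm : Monotone B := monotone_nat_of_le_succ fun n => by
      rw [hBsucc]; exact Set.subset_union_left
    have l1 : Filter.Tendsto (fun n => (μ ψ).real (B n)) Filter.atTop
        (nhds ((μ ψ).real (⋃ n, A n))) := by
      rw [← hBU]
      exact (ENNReal.tendsto_toReal (measure_ne_top _ _)).comp (tendsto_measure_iUnion_atTop hBm)
    -- The masses of `B n` converge by continuity from below, and the equal numbers `‖V n ψ‖²` by
    -- strong convergence.
    refine tendsto_nhds_unique l1 ?_
    simp only [(hV _).2]
    exact (hlim ψ).norm.pow 2

open Classical in
/-- A family of finite measures `μ ψ` with `μ ψ X = ‖ψ‖²`, given on each measurable set by an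
orthogonal projection, is the family of scalar measures of a projection-valued measure. -/
theorem exists_scalarMeasure_real_eq (huniv : ∀ ψ, (μ ψ).real Set.univ = ‖ψ‖ ^ 2)
    (h : ∀ A, MeasurableSet A →
      ∃ T : H →L[ℂ] H, IsStarProjection T ∧ ∀ ψ, (μ ψ).real A = ‖T ψ‖ ^ 2) :
    ∃ P : ProjectionValuedMeasure X H, ∀ A, MeasurableSet A → ∀ ψ, (μ ψ).real A = ‖P A ψ‖ ^ 2 := by
  choose T hT hμ using h
  let F : Set X → H →L[ℂ] H := fun A => if hA : MeasurableSet A then T A hA else 0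
  have hF : ∀ A, MeasurableSet A → IsStarProjection (F A) := fun A hA => by
    simpa [F, hA] using hT A hA
  have hFμ : ∀ A, MeasurableSet A → ∀ ψ, (μ ψ).real A = ‖F A ψ‖ ^ 2 := fun A hA ψ => by
    simpa [F, hA] using hμ A hA ψ
  have hle : ∀ A B, MeasurableSet A → MeasurableSet B → Disjoint A B → ∀ ψ,
      ‖F A ψ‖ ^ 2 + ‖F B ψ‖ ^ 2 ≤ ‖ψ‖ ^ 2 := by
    intro A B hA hB hAB ψ
    rw [← hFμ A hA, ← hFμ B hB, ← huniv, ← measureReal_union hAB hB]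
    exact measureReal_mono (Set.subset_univ _)
  have hmul : ∀ A B, MeasurableSet A → MeasurableSet B → Disjoint A B → F A * F B = 0 :=
    fun A B hA hB hAB => (hF B hB).mul_eq_zero_of_norm_sq_add_le (hle B A hB hA hAB.symm)
  have hadd : ∀ A B, MeasurableSet A → MeasurableSet B → Disjoint A B → F (A ∪ B) = F A + F B := by
    intro A B hA hB hAB
    have h1 := (hF A hA).add_of_norm_sq_add_le (hF B hB) (hle A B hA hB hAB)
    refine (hF _ (hA.union hB)).ext_norm_apply h1 fun ψ => ?_
    rw [(hF A hA).norm_sq_add_apply (hF B hB) h1, ← hFμ A hA, ← hFμ B hB, ← hFμ _ (hA.union hB),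
      measureReal_union hAB hB]
  have hempty : F ∅ = 0 := by
    refine (hF ∅ .empty).ext_norm_apply (.zero _) fun ψ => ?_
    rw [← hFμ ∅ .empty]
    simp
  have hsum : ∀ (A : ℕ → Set X), (∀ n, MeasurableSet (A n)) →
      Pairwise (Function.onFun Disjoint A) → ∀ s : Finset ℕ,
      F (⋃ n ∈ s, A n) = ∑ n ∈ s, F (A n) := by
    intro A hA hd s
    induction s using Finset.induction_on with
    | empty => simpa using hempty
    | insert i s hi ih =>
      rw [Finset.set_biUnion_insert, Finset.sum_insert hi, hadd _ _ (hA i)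
        (Finset.measurableSet_biUnion _ fun i _ => hA i), ih]
      simp only [Set.disjoint_iUnion_right]
      exact fun j hj => hd (by rintro rfl; exact hi hj)
  refine ⟨⟨F, hF, ?_, ?_, ?_, fun A hA => dif_neg hA⟩, hFμ⟩
  · refine (hF _ .univ).ext_norm_apply (.one _) fun ψ => ?_
    rw [← hFμ _ .univ, huniv, one_apply_eq_self]
  · intro A B hA hB
    have hAB := hA.inter hB
    -- `A ∩ B`, `A \ B` and `B \ A` are disjoint, so in the product `F A * F B` only the square of
    -- `F (A ∩ B)` survives.
    have h1 : F A = F (A ∩ B) + F (A \ B) := by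
      rw [← hadd _ _ hAB (hA.diff hB) (Set.disjoint_sdiff_inter.symm), Set.inter_union_sdiff]
    have h2 : F B = F (A ∩ B) + F (B \ A) := by
      rw [Set.inter_comm, ← hadd _ _ (hB.inter hA) (hB.diff hA) (Set.disjoint_sdiff_inter.symm),
        Set.inter_union_sdiff]
    rw [h1, h2, add_mul, mul_add, mul_add, (hF _ hAB).isIdempotentElem.eq,
      hmul _ _ hAB (hB.diff hA), hmul _ _ (hA.diff hB) hAB, hmul _ _ (hA.diff hB) (hB.diff hA)]
    · simp
    · exact Set.disjoint_left.mpr fun x hx hx' => hx'.2 hx.1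
    · exact Set.disjoint_left.mpr fun x hx hx' => hx.2 hx'.2
    · exact Set.disjoint_left.mpr fun x hx hx' => hx'.2 hx.1
  · intro A hA hd ψ
    have hU := MeasurableSet.iUnion hA
    have hs : ∀ s : Finset ℕ, MeasurableSet (⋃ n ∈ s, A n) :=
      fun s => Finset.measurableSet_biUnion _ fun i _ => hA i
    have hsub : ∀ s : Finset ℕ, ⋃ n ∈ s, A n ⊆ ⋃ n, A n :=
      fun s => Set.iUnion₂_subset fun i _ => Set.subset_iUnion A i
    -- The remainder is `F` of the uncovered part applied to `ψ`, so its squared norm is a scalar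
    -- mass; strong countable additivity reduces to that of `μ ψ`.
    have hnorm : ∀ s : Finset ℕ, ‖F (⋃ n, A n) ψ - ∑ n ∈ s, F (A n) ψ‖ ^ 2 =
        (μ ψ).real (⋃ n, A n) - ∑ n ∈ s, (μ ψ).real (A n) := by
      intro s
      have h1 : F (⋃ n, A n) = ∑ n ∈ s, F (A n) + F ((⋃ n, A n) \ ⋃ n ∈ s, A n) := by
        rw [← hsum A hA hd, ← hadd _ _ (hs s) (hU.diff (hs s)) Set.disjoint_sdiff_right,
          Set.union_sdiff_cancel (hsub s)]
      have h2 : F (⋃ n, A n) ψ - ∑ n ∈ s, F (A n) ψ = F ((⋃ n, A n) \ ⋃ n ∈ s, A n) ψ := by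
        rw [h1, _root_.add_apply, _root_.sum_apply, add_sub_cancel_left]
      rw [h2, ← hFμ _ (hU.diff (hs s)), measureReal_sdiff (hsub s) (hs s),
        measureReal_biUnion_finset (fun i _ j _ hij => hd hij) fun i _ => hA i]
    have hm : HasSum (fun n => (μ ψ).real (A n)) ((μ ψ).real (⋃ n, A n)) := by
      have := ENNReal.hasSum_toReal (f := fun n => μ ψ (A n))
        (by rw [← measure_iUnion hd hA]; exact measure_ne_top _ _)
      rwa [← ENNReal.tsum_toReal_eq (fun _ => measure_ne_top _ _), ← measure_iUnion hd hA] at this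
    rw [HasSum, SummationFilter.unconditional_filter, tendsto_iff_norm_sub_tendsto_zero]
    have hm' : Filter.Tendsto (fun s : Finset ℕ =>
        (μ ψ).real (⋃ n, A n) - ∑ n ∈ s, (μ ψ).real (A n)) Filter.atTop (nhds 0) := by
      have := hm.const_sub ((μ ψ).real (⋃ n, A n))
      simpa using this
    have := hm'.sqrt
    rw [Real.sqrt_zero] at this
    refine this.congr fun s => ?_
    rw [← hnorm, Real.sqrt_sq (norm_nonneg _), norm_sub_rev]

end Construction

end ProjectionValuedMeasure

/-! ### Cylinders, the shift and its inverse branches -/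

namespace Cuntz

section CantorGroup

variable {N : ℕ}

theorem cylinder_zero (I : Fin 0 → ZMod N) : cylinder I = Set.univ :=
  Set.eq_univ_of_forall fun _ k => k.elim0

theorem cylinder_eq_iInter {n : ℕ} (I : Fin n → ZMod N) :
    cylinder I = ⋂ k : Fin n, (fun ω : CantorGroup N => ω k) ⁻¹' {I k} := by
  ext ω
  simp [cylinder]

theorem isClopen_cylinder {n : ℕ} (I : Fin n → ZMod N) : IsClopen (cylinder I) := by
  rw [cylinder_eq_iInter]
  exact isClopen_iInter_of_finite fun k => (isClopen_discrete _).preimage (continuous_apply _)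

theorem measurableSet_cylinder {n : ℕ} (I : Fin n → ZMod N) : MeasurableSet (cylinder I) := by
  rw [cylinder_eq_iInter]
  exact MeasurableSet.iInter fun k => measurable_pi_apply _ (measurableSet_singleton _)

theorem disjoint_cylinder {n : ℕ} {I J : Fin n → ZMod N} (h : I ≠ J) :
    Disjoint (cylinder I) (cylinder J) :=
  Set.disjoint_left.mpr fun _ hI hJ => h (funext fun k => (hI k).symm.trans (hJ k))

theorem mem_cylinder_restrict (ω : CantorGroup N) (n : ℕ) :
    ω ∈ cylinder fun k : Fin n => ω k := fun _ => rfl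

/-- A common point makes `I` a prefix of `J`: cylinders are nested or disjoint. -/
theorem inter_cylinder_of_le {m n : ℕ} (hmn : m ≤ n) {I : Fin m → ZMod N} {J : Fin n → ZMod N}
    (h : (cylinder I ∩ cylinder J).Nonempty) : cylinder I ∩ cylinder J = cylinder J := by
  refine Set.inter_eq_right.mpr fun ω hω k => ?_
  obtain ⟨ω', hI, hJ⟩ := h
  exact (hω ⟨k, k.2.trans_le hmn⟩).trans ((hJ ⟨k, k.2.trans_le hmn⟩).symm.trans (hI k))

theorem isPiSystem_cylinder :
    IsPiSystem {A : Set (CantorGroup N) | ∃ (n : ℕ) (I : Fin n → ZMod N), A = cylinder I} := by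
  rintro _ ⟨m, I, rfl⟩ _ ⟨n, J, rfl⟩ h
  rcases le_total m n with hmn | hnm
  · exact ⟨n, J, inter_cylinder_of_le hmn h⟩
  · rw [Set.inter_comm] at h ⊢
    exact ⟨m, I, inter_cylinder_of_le hnm h⟩

theorem measurableSpace_eq_generateFrom_cylinder [NeZero N] :
    (inferInstance : MeasurableSpace (CantorGroup N)) = MeasurableSpace.generateFrom
      {A : Set (CantorGroup N) | ∃ (n : ℕ) (I : Fin n → ZMod N), A = cylinder I} := by
  refine le_antisymm ?_ (MeasurableSpace.generateFrom_le ?_)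
  · refine iSup_le fun k => ?_
    rw [← measurable_iff_comap_le]
    refine @measurable_to_countable' _ _ _ _ (MeasurableSpace.generateFrom _) _ fun a => ?_
    -- Letters are indexed from `0`, so words of length `k + 1` are needed to see letter `k`.
    have h : (fun ω : CantorGroup N => ω k) ⁻¹' {a} =
        ⋃ I ∈ {I : Fin (k + 1) → ZMod N | I (Fin.last k) = a}, cylinder I := by
      ext ω
      simp only [Set.mem_preimage, Set.mem_singleton_iff, Set.mem_ofPred_eq, Set.mem_iUnion,
        exists_prop]
      exact ⟨fun h => ⟨_, h, mem_cylinder_restrict ω (k + 1)⟩,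
        fun ⟨I, hI, hω⟩ => (hω (Fin.last k)).trans hI⟩
    rw [h]
    exact MeasurableSet.biUnion (Set.to_countable _) fun I _ =>
      MeasurableSpace.measurableSet_generateFrom ⟨_, I, rfl⟩
  · rintro _ ⟨n, I, rfl⟩
    exact measurableSet_cylinder I

theorem ext_of_cylinder [NeZero N] {μ ν : Measure (CantorGroup N)} [IsFiniteMeasure μ]
    (h : ∀ (n : ℕ) (I : Fin n → ZMod N), μ (cylinder I) = ν (cylinder I)) : μ = ν := by
  refine ext_of_generate_finite _ measurableSpace_eq_generateFrom_cylinder isPiSystem_cylinder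
    ?_ ?_
  · rintro _ ⟨n, I, rfl⟩
    exact h n I
  -- The empty word compares the total masses.
  · simpa [cylinder_zero] using h 0 Fin.elim0

theorem measurable_shift : Measurable (shift : CantorGroup N → CantorGroup N) :=
  measurable_pi_lambda _ fun k => measurable_pi_apply (k + 1)

theorem isBoundedMeasurable_comp_shift {f : CantorGroup N → ℂ}
    (hf : ProjectionValuedMeasure.IsBoundedMeasurable f) :
    ProjectionValuedMeasure.IsBoundedMeasurable fun ω => f (shift ω) :=
  ⟨hf.1.comp measurable_shift, hf.2.imp fun _ hC _ => hC _⟩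

theorem measurable_prepend (i : ZMod N) : Measurable (prepend i) :=
  measurable_pi_lambda _ fun k => by
    cases k with
    | zero => exact measurable_const
    | succ k => exact measurable_pi_apply k

theorem prepend_shift (ω : CantorGroup N) : prepend (ω 0) (shift ω) = ω := by
  funext k
  cases k <;> rfl

theorem prepend_image (i : ZMod N) (A : Set (CantorGroup N)) :
    prepend i '' A = (fun ω => ω 0) ⁻¹' {i} ∩ shift ⁻¹' A := by
  ext ω
  constructor
  · rintro ⟨ω, hω, rfl⟩
    exact ⟨rfl, hω⟩
  · rintro ⟨rfl, hω⟩
    exact ⟨shift ω, hω, prepend_shift ω⟩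

theorem measurableSet_prepend_image (i : ZMod N) {A : Set (CantorGroup N)}
    (hA : MeasurableSet A) : MeasurableSet (prepend i '' A) := by
  rw [prepend_image]
  exact (measurable_pi_apply 0 (measurableSet_singleton i)).inter (measurable_shift hA)

theorem prepend_preimage_image_self (i : ZMod N) (A : Set (CantorGroup N)) :
    prepend i ⁻¹' (prepend i '' A) = A := by
  rw [prepend_image]
  ext ω
  exact and_iff_right rfl

theorem prepend_preimage_image_of_ne {i j : ZMod N} (h : j ≠ i) (A : Set (CantorGroup N)) :
    prepend j ⁻¹' (prepend i '' A) = ∅ := by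
  rw [prepend_image]
  exact Set.eq_empty_of_forall_notMem fun ω hω => h hω.1

theorem cylinder_succ {n : ℕ} (I : Fin (n + 1) → ZMod N) :
    cylinder I = prepend (I 0) '' cylinder (Fin.tail I) := by
  rw [prepend_image]
  ext ω
  exact Fin.forall_fin_succ

end CantorGroup

/-! ### Existence of the projection-valued measure -/

section Representation

variable {N : ℕ} {H : Type*} [NormedAddCommGroup H] [InnerProductSpace ℂ H]

theorem wordOp_zero (S : ZMod N → H →L[ℂ] H) (I : Fin 0 → ZMod N) : wordOp S I = 1 := by
  simp [wordOp]

theorem wordOp_succ (S : ZMod N → H →L[ℂ] H) {n : ℕ} (I : Fin (n + 1) → ZMod N) :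
    wordOp S I = S (I 0) * wordOp S (Fin.tail I) := by
  simp [wordOp, List.ofFn_succ, Fin.tail]

variable [CompleteSpace H]

theorem star_wordOp_succ_apply (S : ZMod N → H →L[ℂ] H) {n : ℕ} (I : Fin (n + 1) → ZMod N)
    (ψ : H) : star (wordOp S I) ψ = star (wordOp S (Fin.tail I)) (star (S (I 0)) ψ) := by
  rw [wordOp_succ, star_mul]
  rfl

variable [NeZero N] {S : ZMod N → H →L[ℂ] H}

theorem IsRepresentation.star_mul_self (hS : IsRepresentation S) (i : ZMod N) :
    star (S i) * S i = 1 := by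
  simp [hS.star_mul]

theorem IsRepresentation.star_wordOp_mul_self (hS : IsRepresentation S) {n : ℕ}
    (I : Fin n → ZMod N) : star (wordOp S I) * wordOp S I = 1 := by
  induction n with
  | zero => simp [wordOp_zero]
  | succ n ih =>
    rw [wordOp_succ, StarMul.star_mul, mul_assoc, ← mul_assoc (star (S (I 0))), hS.star_mul_self, one_mul,
      ih]

/-- Conjugation by `W` moves the quadratic form from `ψ` to `W* ψ`; the scalar measures of `S_i* ψ`
enter this way. -/
theorem inner_mul_star_apply (W T : H →L[ℂ] H) (ψ : H) :
    inner ℂ ψ ((W * T * star W) ψ) = inner ℂ (star W ψ) (T (star W ψ)) :=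
  (ContinuousLinearMap.adjoint_inner_left W _ ψ).symm

theorem isStarProjection_mul_star_self {W : H →L[ℂ] H} (hW : star W * W = 1) :
    IsStarProjection (W * star W) := by
  refine ⟨?_, .mul_star_self W⟩
  rw [IsIdempotentElem, mul_assoc, ← mul_assoc (star W), hW, one_mul]

theorem norm_sq_mul_star_apply {W : H →L[ℂ] H} (hW : star W * W = 1) (ψ : H) :
    ‖(W * star W) ψ‖ ^ 2 = ‖star W ψ‖ ^ 2 := by
  have h1 := (isStarProjection_mul_star_self hW).inner_apply_self ψ
  have h2 := inner_mul_star_apply W 1 ψ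
  rw [mul_one, h1, (IsStarProjection.one _).inner_apply_self] at h2
  exact_mod_cast h2

theorem IsRepresentation.sum_norm_sq (hS : IsRepresentation S) (ψ : H) :
    ∑ i, ‖star (S i) ψ‖ ^ 2 = ‖ψ‖ ^ 2 := by
  have h1 := (IsStarProjection.one (H →L[ℂ] H)).inner_apply_self ψ
  rw [← hS.sum_mul_star, _root_.sum_apply, inner_sum] at h1
  simp only [(isStarProjection_mul_star_self (hS.star_mul_self _)).inner_apply_self,
    norm_sq_mul_star_apply (hS.star_mul_self _)] at h1
  -- The identity inside the norm was expanded as well; it is folded back here.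
  rw [← _root_.sum_apply, hS.sum_mul_star] at h1
  exact_mod_cast h1

/-- The `n`-th approximation of the scalar measure of `ψ`: the mass `‖S_I* ψ‖²` is placed at the
point `I00…`, for all words `I` of length `n`. -/
def approxMeasure (S : ZMod N → H →L[ℂ] H) : ℕ → H → Measure (CantorGroup N)
  | 0, ψ => ENNReal.ofReal (‖ψ‖ ^ 2) • Measure.dirac 0
  | n + 1, ψ => ∑ i, (approxMeasure S n (star (S i) ψ)).map (prepend i)

/-- Only the branch that prepends the first letter of `I` reaches its cylinder. -/
theorem sum_map_prepend_cylinder_succ (μ : ZMod N → Measure (CantorGroup N)) {n : ℕ}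
    (I : Fin (n + 1) → ZMod N) :
    (∑ i, (μ i).map (prepend i)) (cylinder I) = μ (I 0) (cylinder (Fin.tail I)) := by
  rw [Measure.finsetSum_apply, Finset.sum_eq_single (I 0)]
  · rw [Measure.map_apply (measurable_prepend _) (measurableSet_cylinder I), cylinder_succ,
      prepend_preimage_image_self]
  · intro j _ hj
    rw [Measure.map_apply (measurable_prepend _) (measurableSet_cylinder I), cylinder_succ,
      prepend_preimage_image_of_ne hj, measure_empty]
  · simp

theorem sum_map_prepend_univ (μ : ZMod N → Measure (CantorGroup N)) :
    (∑ i, (μ i).map (prepend i)) Set.univ = ∑ i, μ i Set.univ := by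
  rw [Measure.finsetSum_apply]
  refine Finset.sum_congr rfl fun i _ => ?_
  rw [Measure.map_apply (measurable_prepend _) .univ, Set.preimage_univ]

theorem approxMeasure_univ (hS : IsRepresentation S) (n : ℕ) (ψ : H) :
    approxMeasure S n ψ Set.univ = ENNReal.ofReal (‖ψ‖ ^ 2) := by
  induction n generalizing ψ with
  | zero => simp [approxMeasure]
  | succ n ih =>
    rw [approxMeasure, sum_map_prepend_univ, ← hS.sum_norm_sq,
      ENNReal.ofReal_sum_of_nonneg fun _ _ => by positivity]
    simp only [ih]

/-- Each level of the recursion peels off one letter, matching `S_I* = S_{tail I}* S_{i₁}*`; the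
vector changes on the way, so the induction runs over all `ψ`. -/
theorem approxMeasure_cylinder (hS : IsRepresentation S) {m n : ℕ} (hmn : m ≤ n)
    (I : Fin m → ZMod N) (ψ : H) :
    approxMeasure S n ψ (cylinder I) = ENNReal.ofReal (‖star (wordOp S I) ψ‖ ^ 2) := by
  induction n generalizing m ψ with
  | zero =>
    obtain rfl := Nat.le_zero.mp hmn
    rw [cylinder_zero, approxMeasure_univ hS, wordOp_zero, star_one, one_apply_eq_self]
  | succ n ih =>
    cases m with
    | zero => rw [cylinder_zero, approxMeasure_univ hS, wordOp_zero, star_one, one_apply_eq_self]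
    | succ m =>
      rw [approxMeasure, sum_map_prepend_cylinder_succ, ih (by omega), star_wordOp_succ_apply]

theorem isFiniteMeasure_approxMeasure (hS : IsRepresentation S) (n : ℕ) (ψ : H) :
    IsFiniteMeasure (approxMeasure S n ψ) :=
  ⟨by rw [approxMeasure_univ hS]; exact ENNReal.ofReal_lt_top⟩

/-- The approximations have the same mass `‖ψ‖²` on a compact space, hence a weak cluster point. A
clopen cylinder has a continuous indicator, and its approximate masses are eventually constant. -/
theorem exists_measure_cylinder (hS : IsRepresentation S) (ψ : H) :
    ∃ μ : Measure (CantorGroup N), IsFiniteMeasure μ ∧ ∀ (n : ℕ) (I : Fin n → ZMod N),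
      μ.real (cylinder I) = ‖star (wordOp S I) ψ‖ ^ 2 := by
  have hf := fun n => isFiniteMeasure_approxMeasure hS n ψ
  let ν : ℕ → FiniteMeasure (CantorGroup N) := fun n => ⟨approxMeasure S n ψ, hf n⟩
  obtain ⟨μ, -, hμ⟩ := (isCompact_setOfPred_finiteMeasure_le_of_compactSpace (CantorGroup N)
    (Real.toNNReal (‖ψ‖ ^ 2))).exists_mapClusterPt (f := Filter.atTop) (u := ν) (by
      rw [Filter.le_principal_iff, Filter.mem_map]
      refine Filter.Eventually.of_forall fun n => ?_
      change (approxMeasure S n ψ Set.univ).toNNReal ≤ _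
      rw [approxMeasure_univ hS]
      rfl)
  refine ⟨μ, inferInstance, fun n I => ?_⟩
  let g := BoundedContinuousFunction.indicator (cylinder I) (isClopen_cylinder I)
  have hg : ∀ ρ : FiniteMeasure (CantorGroup N),
      ∫ x, g x ∂(ρ : Measure (CantorGroup N)) = (ρ : Measure (CantorGroup N)).real (cylinder I) :=
    fun ρ => integral_indicator_one (measurableSet_cylinder I)
  have hlim := FiniteMeasure.tendsto_iff_forall_integral_tendsto.mp
    (Filter.tendsto_id (x := nhds μ)) g
  have hcl := hμ.tendsto_comp hlim
  simp only [Function.comp_def, id, hg] at hcl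
  have hconst : Filter.Tendsto (fun k => (ν k : Measure (CantorGroup N)).real (cylinder I))
      Filter.atTop (nhds (‖star (wordOp S I) ψ‖ ^ 2)) := by
    refine tendsto_const_nhds.congr' ?_
    filter_upwards [Filter.eventually_ge_atTop n] with k hk
    change _ = (approxMeasure S k ψ (cylinder I)).toReal
    rw [approxMeasure_cylinder hS hk, ENNReal.toReal_ofReal (by positivity)]
  -- `μ` is only a cluster point, but a cluster point of a convergent real sequence is its limit.
  have : (nhds ((μ : Measure (CantorGroup N)).real (cylinder I)) ⊓ nhds _).NeBot :=
    Filter.NeBot.mono hcl (inf_le_inf_left _ hconst)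
  exact eq_of_nhds_neBot this

theorem IsRepresentation.exists_projectionValuedMeasure (hS : IsRepresentation S) :
    ∃ P : ProjectionValuedMeasure (CantorGroup N) H, ∀ (n : ℕ) (I : Fin n → ZMod N),
      P (cylinder I) = wordOp S I * star (wordOp S I) := by
  choose μ hfin hμ using fun ψ => exists_measure_cylinder hS ψ
  have huniv : ∀ ψ, (μ ψ).real Set.univ = ‖ψ‖ ^ 2 := fun ψ => by
    have := hμ ψ 0 Fin.elim0
    rwa [cylinder_zero, wordOp_zero, star_one, one_apply_eq_self] at this
  have hW := fun (n : ℕ) (I : Fin n → ZMod N) => hS.star_wordOp_mul_self I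
  obtain ⟨P, hP⟩ := ProjectionValuedMeasure.exists_scalarMeasure_real_eq huniv
    (ProjectionValuedMeasure.exists_isStarProjection_of_generateFrom
      measurableSpace_eq_generateFrom_cylinder isPiSystem_cylinder huniv (by
        rintro _ ⟨n, I, rfl⟩
        exact ⟨_, isStarProjection_mul_star_self (hW n I), fun ψ => by
          rw [hμ, norm_sq_mul_star_apply (hW n I)]⟩))
  refine ⟨P, fun n I => ?_⟩
  refine (P.isStarProjection' _ (measurableSet_cylinder I)).ext_norm_apply
    (isStarProjection_mul_star_self (hW n I)) fun ψ => ?_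
  rw [← hP _ (measurableSet_cylinder I), hμ, norm_sq_mul_star_apply (hW n I)]

end Representation

/-! ### Characters of the Cantor group -/

section Pairing

variable {N : ℕ}

theorem exists_forall_ge_eq_zero (ξ : DualGroup N) : ∃ n, ∀ k, n ≤ k → ξ k = 0 := by
  obtain ⟨n, hn⟩ := ξ.support.bddAbove
  refine ⟨n + 1, fun k hk => ?_⟩
  by_contra h
  have : k ≤ n := hn (Finsupp.mem_support_iff.mpr h)
  omega

variable [NeZero N]

/-- Zero coordinates contribute `1`. A common range replaces the supports, which differ for `ξ`, `η`
and `ξ + η`, and `ZMod.stdAddChar` is additive whereas representatives `val` are not. -/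
theorem pairing_eq_prod_range {n : ℕ} {ξ : DualGroup N} (hξ : ∀ k, n ≤ k → ξ k = 0)
    (ω : CantorGroup N) :
    pairing ω ξ = ∏ k ∈ Finset.range n, ZMod.stdAddChar (ω k * ξ k) := by
  have hterm : ∀ a b : ZMod N, Complex.exp (2 * Real.pi * Complex.I *
      ((a.val : ℂ) * (b.val : ℂ)) / (N : ℂ)) = ZMod.stdAddChar (a * b) := by
    intro a b
    have := ZMod.stdAddChar_coe (N := N) ((a.val : ℤ) * (b.val : ℤ))
    push_cast at this
    rw [← this, ZMod.natCast_zmod_val, ZMod.natCast_zmod_val]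
  simp only [pairing, hterm]
  refine Finset.prod_subset (fun k hk => ?_) fun k _ hk => ?_
  · rw [Finset.mem_range]
    by_contra h
    exact Finsupp.mem_support_iff.mp hk (hξ k (not_lt.mp h))
  · rw [Finsupp.notMem_support_iff.mp hk, mul_zero, AddChar.map_zero_eq_one]

theorem pairing_zero_right (ω : CantorGroup N) : pairing ω (0 : DualGroup N) = 1 := by
  simp [pairing]

theorem pairing_add_right (ω : CantorGroup N) (ξ η : DualGroup N) :
    pairing ω (ξ + η) = pairing ω ξ * pairing ω η := by
  obtain ⟨m, hm⟩ := exists_forall_ge_eq_zero ξ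
  obtain ⟨n, hn⟩ := exists_forall_ge_eq_zero η
  have hm' : ∀ k, max m n ≤ k → ξ k = 0 := fun k hk => hm k ((le_max_left _ _).trans hk)
  have hn' : ∀ k, max m n ≤ k → η k = 0 := fun k hk => hn k ((le_max_right _ _).trans hk)
  rw [pairing_eq_prod_range hm', pairing_eq_prod_range hn', ← Finset.prod_mul_distrib,
    pairing_eq_prod_range (n := max m n) fun k hk => by
      rw [Finsupp.add_apply, hm' k hk, hn' k hk, add_zero]]
  exact Finset.prod_congr rfl fun k _ => by
    rw [Finsupp.add_apply, mul_add, AddChar.map_add_eq_mul]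

theorem pairing_neg_right (ω : CantorGroup N) (ξ : DualGroup N) :
    pairing ω (-ξ) = star (pairing ω ξ) := by
  obtain ⟨n, hn⟩ := exists_forall_ge_eq_zero ξ
  rw [pairing_eq_prod_range hn, pairing_eq_prod_range (n := n) fun k hk => by
    rw [Finsupp.neg_apply, hn k hk, neg_zero], star_prod]
  exact Finset.prod_congr rfl fun k _ => by
    rw [Finsupp.neg_apply, mul_neg]
    exact AddChar.map_neg_eq_conj _ _

theorem norm_pairing (ω : CantorGroup N) (ξ : DualGroup N) : ‖pairing ω ξ‖ = 1 := by
  have h : pairing ω ξ * star (pairing ω ξ) = 1 := by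
    rw [← pairing_neg_right, ← pairing_add_right, add_neg_cancel, pairing_zero_right]
  have h' := congrArg norm h
  rw [norm_mul, norm_star, norm_one] at h'
  nlinarith [norm_nonneg (pairing ω ξ)]

theorem pairing_eq_of_mem_cylinder {n : ℕ} {ξ : DualGroup N} (hξ : ∀ k, n ≤ k → ξ k = 0)
    {I : Fin n → ZMod N} {ω : CantorGroup N} (hω : ω ∈ cylinder I) :
    pairing ω ξ = pairing (extendZero I) ξ := by
  rw [pairing_eq_prod_range hξ, pairing_eq_prod_range hξ]
  refine Finset.prod_congr rfl fun k hk => ?_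
  have hk' := Finset.mem_range.mp hk
  have : extendZero I k = I ⟨k, hk'⟩ := dif_pos hk'
  rw [this, hω ⟨k, hk'⟩]

/-- The cylinders of length `n` partition the group, and the character is constant on each. -/
theorem pairing_eq_sum_indicator {n : ℕ} {ξ : DualGroup N} (hξ : ∀ k, n ≤ k → ξ k = 0)
    (ω : CantorGroup N) : pairing ω ξ =
      ∑ I : Fin n → ZMod N, (cylinder I).indicator (fun _ => pairing (extendZero I) ξ) ω := by
  rw [Finset.sum_eq_single fun k : Fin n => ω k]
  · rw [Set.indicator_of_mem (mem_cylinder_restrict ω n),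
      pairing_eq_of_mem_cylinder hξ (mem_cylinder_restrict ω n)]
  · intro I _ hI
    refine Set.indicator_of_notMem (fun h => ?_) _
    exact hI (funext fun k => (h k).symm)
  · simp

theorem isBoundedMeasurable_pairing (ξ : DualGroup N) :
    ProjectionValuedMeasure.IsBoundedMeasurable fun ω : CantorGroup N => pairing ω ξ := by
  refine ⟨?_, 1, fun ω => (norm_pairing ω ξ).le⟩
  obtain ⟨n, hn⟩ := exists_forall_ge_eq_zero ξ
  rw [funext (pairing_eq_sum_indicator hn)]
  exact Finset.measurable_sum _ fun I _ =>
    measurable_const.indicator (measurableSet_cylinder I)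

end Pairing

/-! ### The unitary representation of the dual group -/

section Spectral

variable {N : ℕ} {H : Type*} [NormedAddCommGroup H] [InnerProductSpace ℂ H]
  [CompleteSpace H] (P : ProjectionValuedMeasure (CantorGroup N) H)

theorem cylinder_mul_cylinder {n : ℕ} (I J : Fin n → ZMod N) :
    P (cylinder I) * P (cylinder J) = if I = J then P (cylinder I) else 0 := by
  rw [← P.inter' _ _ (measurableSet_cylinder I) (measurableSet_cylinder J)]
  split_ifs with h
  · rw [h, Set.inter_self]
  · rw [(disjoint_cylinder h).inter_eq, P.empty]

variable [NeZero N]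

/-- The integral `∫ ⟨ω, ξ⟩ P(dω)` of the character `ξ`. -/
def charOp (ξ : DualGroup N) : H →L[ℂ] H := P.integral fun ω => pairing ω ξ

/-- The left side does not mention `n`, so the sum defining `U(ξ)` does not depend on it. -/
theorem charOp_eq_sum {n : ℕ} {ξ : DualGroup N} (hξ : ∀ k, n ≤ k → ξ k = 0) :
    charOp P ξ = ∑ I : Fin n → ZMod N, pairing (extendZero I) ξ • P (cylinder I) := by
  refine (P.hasIntegral_integral (isBoundedMeasurable_pairing ξ)).unique fun ψ => ?_
  change _ = ∫ ω, pairing ω ξ ∂_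
  rw [funext (pairing_eq_sum_indicator hξ), integral_finsetSum _ fun I _ =>
    (integrable_const _).indicator (measurableSet_cylinder I), _root_.sum_apply, inner_sum]
  refine Finset.sum_congr rfl fun I _ => ?_
  rw [integral_indicator_const _ (measurableSet_cylinder I),
    P.scalarMeasure_real_apply ψ (measurableSet_cylinder I), _root_.smul_apply, inner_smul_right,
    P.inner_self (measurableSet_cylinder I), Complex.real_smul, mul_comm]

theorem charOp_zero : charOp P 0 = 1 := by
  rw [charOp_eq_sum P (n := 0) fun _ _ => rfl]
  simp [cylinder_zero, P.univ', pairing_zero_right]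

/-- At a common word length the cylinder projections are mutually orthogonal, so the double sum
collapses to its diagonal. -/
theorem charOp_add (ξ η : DualGroup N) : charOp P (ξ + η) = charOp P ξ * charOp P η := by
  obtain ⟨m, hm⟩ := exists_forall_ge_eq_zero ξ
  obtain ⟨n, hn⟩ := exists_forall_ge_eq_zero η
  have hm' : ∀ k, max m n ≤ k → ξ k = 0 := fun k hk => hm k ((le_max_left _ _).trans hk)
  have hn' : ∀ k, max m n ≤ k → η k = 0 := fun k hk => hn k ((le_max_right _ _).trans hk)
  rw [charOp_eq_sum P hm', charOp_eq_sum P hn', charOp_eq_sum P (n := max m n) fun k hk => by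
      rw [Finsupp.add_apply, hm' k hk, hn' k hk, add_zero], Finset.sum_mul_sum]
  refine Finset.sum_congr rfl fun I _ => ?_
  simp only [smul_mul_smul_comm, cylinder_mul_cylinder, smul_ite, smul_zero,
    Finset.sum_ite_eq, Finset.mem_univ, if_true, pairing_add_right]

theorem star_charOp (ξ : DualGroup N) : star (charOp P ξ) = charOp P (-ξ) := by
  obtain ⟨n, hn⟩ := exists_forall_ge_eq_zero ξ
  rw [charOp_eq_sum P hn, charOp_eq_sum P (n := n) fun k hk => by
    rw [Finsupp.neg_apply, hn k hk, neg_zero], star_sum]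
  refine Finset.sum_congr rfl fun I _ => ?_
  rw [star_smul, pairing_neg_right,
    (P.isStarProjection' _ (measurableSet_cylinder I)).isSelfAdjoint.star_eq]

/-- The unitary representation of the dual group with spectral measure `P`. -/
def unitaryRep : Multiplicative (DualGroup N) →* unitary (H →L[ℂ] H) where
  toFun ξ := ⟨charOp P ξ.toAdd, by
    rw [Unitary.mem_iff, star_charOp, ← charOp_add, ← charOp_add, neg_add_cancel, add_neg_cancel,
      charOp_zero]
    exact ⟨rfl, rfl⟩⟩
  map_one' := Subtype.ext (charOp_zero P)
  map_mul' ξ η := Subtype.ext (charOp_add P ξ.toAdd η.toAdd)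

theorem coe_unitaryRep_ofAdd (ξ : DualGroup N) :
    (unitaryRep P (Multiplicative.ofAdd ξ) : H →L[ℂ] H) = P.integral fun ω => pairing ω ξ := rfl

end Spectral

/-! ### The canonical endomorphism and covariance under the shift -/

section Endomorphism

variable {N : ℕ} [NeZero N] {H : Type*} [NormedAddCommGroup H] [InnerProductSpace ℂ H]
  [CompleteSpace H] {S : ZMod N → H →L[ℂ] H}

/-- The endomorphism `T ↦ ∑ᵢ Sᵢ T Sᵢ*` of `B(H)`. -/
def canonicalEndomorphism (hS : IsRepresentation S) : (H →L[ℂ] H) →⋆ₐ[ℂ] (H →L[ℂ] H) where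
  toFun T := ∑ i, S i * T * star (S i)
  map_one' := by simp only [mul_one, hS.sum_mul_star]
  map_mul' T T' := by
    rw [Finset.sum_mul_sum]
    refine Finset.sum_congr rfl fun i _ => ?_
    -- The relation `S_i* S_j = δ_ij` removes the off-diagonal terms.
    have h : ∀ j, S i * T * star (S i) * (S j * T' * star (S j)) =
        if i = j then S i * (T * T') * star (S i) else 0 := by
      intro j
      rw [show S i * T * star (S i) * (S j * T' * star (S j)) =
        S i * T * (star (S i) * S j) * T' * star (S j) by simp only [mul_assoc], hS.star_mul]
      split_ifs with hij
      · subst hij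
        simp only [mul_assoc, one_mul]
      · simp
    simp only [h, Finset.sum_ite_eq, Finset.mem_univ, if_true]
  map_zero' := by simp
  map_add' T T' := by simp only [mul_add, add_mul, Finset.sum_add_distrib]
  commutes' c := by
    simp only [Algebra.algebraMap_eq_smul_one, mul_smul_comm, smul_mul_assoc, mul_one,
      ← Finset.smul_sum, hS.sum_mul_star]
  map_star' T := by
    simp only [star_sum, StarMul.star_mul, star_star, mul_assoc]

theorem canonicalEndomorphism_apply (hS : IsRepresentation S) (T : H →L[ℂ] H) :
    canonicalEndomorphism hS T = ∑ i, S i * T * star (S i) := rfl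

variable {P : ProjectionValuedMeasure (CantorGroup N) H}

/-- Self-similarity of the scalar measures. On a nonempty word both sides equal `‖S_I* ψ‖²`; on the
empty word it is `∑ᵢ ‖S_i* ψ‖² = ‖ψ‖²`. -/
theorem scalarMeasure_eq_sum_map_prepend (hS : IsRepresentation S)
    (hP : ∀ (n : ℕ) (I : Fin n → ZMod N), P (cylinder I) = wordOp S I * star (wordOp S I))
    (ψ : H) :
    P.scalarMeasure ψ = ∑ i, (P.scalarMeasure (star (S i) ψ)).map (prepend i) := by
  refine ext_of_cylinder fun n I => ?_
  cases n with
  | zero =>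
    rw [cylinder_zero, sum_map_prepend_univ]
    simp only [P.scalarMeasure_apply _ .univ, P.univ', one_apply_eq_self]
    rw [← hS.sum_norm_sq, ENNReal.ofReal_sum_of_nonneg fun _ _ => by positivity]
  | succ n =>
    rw [sum_map_prepend_cylinder_succ, P.scalarMeasure_apply _ (measurableSet_cylinder _),
      P.scalarMeasure_apply _ (measurableSet_cylinder _), hP, hP,
      norm_sq_mul_star_apply (hS.star_wordOp_mul_self _),
      norm_sq_mul_star_apply (hS.star_wordOp_mul_self _), star_wordOp_succ_apply]

theorem sum_mul_prepend_preimage_mul_star (hS : IsRepresentation S)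
    (hP : ∀ (n : ℕ) (I : Fin n → ZMod N), P (cylinder I) = wordOp S I * star (wordOp S I))
    {A : Set (CantorGroup N)} (hA : MeasurableSet A) :
    ∑ i, S i * P (prepend i ⁻¹' A) * star (S i) = P A := by
  have hpre := fun i => measurable_prepend i hA
  refine ContinuousLinearMap.ext_inner_apply_self fun ψ => ?_
  rw [_root_.sum_apply, inner_sum, P.inner_self hA, ← P.scalarMeasure_real_apply ψ hA,
    scalarMeasure_eq_sum_map_prepend hS hP, Measure.real,
    Measure.finsetSum_apply, ENNReal.toReal_sum fun _ _ => measure_ne_top _ _, Complex.ofReal_sum]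
  refine Finset.sum_congr rfl fun i _ => ?_
  rw [inner_mul_star_apply, P.inner_self (hpre i), ← P.scalarMeasure_real_apply _ (hpre i),
    ← map_measureReal_apply (measurable_prepend i) hA]
  rfl

/-- The branches have disjoint ranges, so the decomposition of `P (σ_i A)` has a single nonzero
term. -/
theorem mul_mul_star_eq_prepend_image (hS : IsRepresentation S)
    (hP : ∀ (n : ℕ) (I : Fin n → ZMod N), P (cylinder I) = wordOp S I * star (wordOp S I))
    (i : ZMod N) {A : Set (CantorGroup N)} (hA : MeasurableSet A) :
    S i * P A * star (S i) = P (prepend i '' A) := by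
  rw [← sum_mul_prepend_preimage_mul_star hS hP (measurableSet_prepend_image i hA),
    Finset.sum_eq_single i, prepend_preimage_image_self]
  · intro j _ hj
    rw [prepend_preimage_image_of_ne hj, P.empty, mul_zero, zero_mul]
  · simp

theorem canonicalEndomorphism_projection (hS : IsRepresentation S)
    (hP : ∀ (n : ℕ) (I : Fin n → ZMod N), P (cylinder I) = wordOp S I * star (wordOp S I))
    {A : Set (CantorGroup N)} (hA : MeasurableSet A) :
    canonicalEndomorphism hS (P A) = P (shift ⁻¹' A) :=
  -- Since `σ ∘ σ_i = id` holds by definition, `σ_i⁻¹ (σ⁻¹ A)` is `A` itself.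
  sum_mul_prepend_preimage_mul_star hS hP (measurable_shift hA)

theorem map_shift_scalarMeasure (hS : IsRepresentation S)
    (hP : ∀ (n : ℕ) (I : Fin n → ZMod N), P (cylinder I) = wordOp S I * star (wordOp S I))
    (ψ : H) :
    (P.scalarMeasure ψ).map shift = ∑ i, P.scalarMeasure (star (S i) ψ) := by
  conv_lhs => rw [scalarMeasure_eq_sum_map_prepend hS hP]
  refine Measure.ext fun A hA => ?_
  rw [Measure.map_apply measurable_shift hA, Measure.finsetSum_apply, Measure.finsetSum_apply]
  exact Finset.sum_congr rfl fun i _ => Measure.map_apply (measurable_prepend i)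
    (measurable_shift hA)

/-- In quadratic forms, both sides integrate `f` against `σ_* μ_ψ = ∑ᵢ μ_{S_i* ψ}`. -/
theorem canonicalEndomorphism_integral (hS : IsRepresentation S)
    (hP : ∀ (n : ℕ) (I : Fin n → ZMod N), P (cylinder I) = wordOp S I * star (wordOp S I))
    {f : CantorGroup N → ℂ} (hf : ProjectionValuedMeasure.IsBoundedMeasurable f) :
    canonicalEndomorphism hS (P.integral f) = P.integral fun ω => f (shift ω) := by
  refine ContinuousLinearMap.ext_inner_apply_self fun ψ => ?_
  rw [P.hasIntegral_integral (isBoundedMeasurable_comp_shift hf),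
    ← integral_map measurable_shift.aemeasurable hf.1.aestronglyMeasurable,
    map_shift_scalarMeasure hS hP, integral_finsetSum_measure fun i _ => hf.integrable _,
    canonicalEndomorphism_apply, _root_.sum_apply, inner_sum]
  exact Finset.sum_congr rfl fun i _ => by
    rw [inner_mul_star_apply, P.hasIntegral_integral hf]

end Endomorphism

end Cuntz

end

theorem theorem2 (N : ℕ) [NeZero N] (hN : 2 ≤ N) {H : Type*} [NormedAddCommGroup H]
    [InnerProductSpace ℂ H] [CompleteSpace H] (S : ZMod N → H →L[ℂ] H)
    (hS : Cuntz.IsRepresentation S) :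
    -- there is exactly one projection-valued measure with the prescribed values on cylinders
    ∃ P : ProjectionValuedMeasure (Cuntz.CantorGroup N) H,
      (∀ (n : ℕ) (I : Fin n → ZMod N),
        P (Cuntz.cylinder I) = Cuntz.wordOp S I * star (Cuntz.wordOp S I)) ∧
      (∀ Q : ProjectionValuedMeasure (Cuntz.CantorGroup N) H,
        (∀ (n : ℕ) (I : Fin n → ZMod N),
          Q (Cuntz.cylinder I) = Cuntz.wordOp S I * star (Cuntz.wordOp S I)) → Q = P) ∧
      -- the unitary representation `U` of the (discrete) dual group and the endomorphism `α`
      ∃ (U : Multiplicative (Cuntz.DualGroup N) →* unitary (H →L[ℂ] H))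
        (α : (H →L[ℂ] H) →⋆ₐ[ℂ] (H →L[ℂ] H)),
        (∀ (ξ : Cuntz.DualGroup N) (n : ℕ), (∀ k, n ≤ k → ξ k = 0) →
          (U (Multiplicative.ofAdd ξ) : H →L[ℂ] H) =
            ∑ I : Fin n → ZMod N, Cuntz.pairing (Cuntz.extendZero I) ξ •
              (Cuntz.wordOp S I * star (Cuntz.wordOp S I))) ∧
        (∀ T : H →L[ℂ] H, α T = ∑ i, S i * T * star (S i)) ∧
        -- `P` is the spectral measure of `U`
        (∀ ξ : Cuntz.DualGroup N,
          (U (Multiplicative.ofAdd ξ) : H →L[ℂ] H) = P.integral fun ω => Cuntz.pairing ω ξ) ∧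
        (∀ (i : ZMod N) (A : Set (Cuntz.CantorGroup N)), MeasurableSet A →
          S i * P A * star (S i) = P (Cuntz.prepend i '' A)) ∧
        (∀ A : Set (Cuntz.CantorGroup N), MeasurableSet A →
          ∑ i, S i * P (Cuntz.prepend i ⁻¹' A) * star (S i) = P A) ∧
        (∀ A : Set (Cuntz.CantorGroup N), MeasurableSet A → α (P A) = P (Cuntz.shift ⁻¹' A)) ∧
        (∀ f : Cuntz.CantorGroup N → ℂ, ProjectionValuedMeasure.IsBoundedMeasurable f →
          α (P.integral f) = P.integral fun ω => f (Cuntz.shift ω)) ∧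
        (∀ ξ : Cuntz.DualGroup N,
          α (U (Multiplicative.ofAdd ξ) : H →L[ℂ] H) =
            (U (Multiplicative.ofAdd (Cuntz.dualShift ξ)) : H →L[ℂ] H)) := by
  obtain ⟨P, hP⟩ := hS.exists_projectionValuedMeasure
  refine ⟨P, hP, fun Q hQ => ?_, Cuntz.unitaryRep P, Cuntz.canonicalEndomorphism hS, ?_,
    Cuntz.canonicalEndomorphism_apply hS, Cuntz.coe_unitaryRep_ofAdd P,
    fun i A hA => Cuntz.mul_mul_star_eq_prepend_image hS hP i hA,
    fun A hA => Cuntz.sum_mul_prepend_preimage_mul_star hS hP hA,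
    fun A hA => Cuntz.canonicalEndomorphism_projection hS hP hA,
    fun f hf => Cuntz.canonicalEndomorphism_integral hS hP hf, fun ξ => ?_⟩
  · refine ProjectionValuedMeasure.ext_of_generateFrom
      Cuntz.measurableSpace_eq_generateFrom_cylinder Cuntz.isPiSystem_cylinder ?_
    rintro _ ⟨n, I, rfl⟩
    rw [hP, hQ]
  · intro ξ n hξ
    simp only [← hP]
    exact Cuntz.charOp_eq_sum P hξ
  · rw [Cuntz.coe_unitaryRep_ofAdd, Cuntz.coe_unitaryRep_ofAdd,
      Cuntz.canonicalEndomorphism_integral hS hP (Cuntz.isBoundedMeasurable_pairing ξ)]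
    -- The case of characters is the integral formula combined with `⟨σ ω, ξ⟩ = ⟨ω, σ̂ ξ⟩`.
    simp only [Cuntz.pairing_dualShift]
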